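/- **Setting.** $\mathsf{LTL}_f$ formulas over a set $P$ of atomic propositions are built from $tt$, $f\!f$ and the atoms in $P$ by $\neg,\wedge,\vee$, strong next $X$, weak next $N$, until $U$ and release $R$. They are interpreted over nonempty finite sequences of subsets of $P$ in the usual way ($X\psi$ fails and $N\psi$ holds at the last position). A formula is satisfiable if some nonempty finite trace satisfies it at its first position. *Tail normal form.* Let $Tail\notin P$ be a new atom. For $\varphi$ in negation normal form define $t(\varphi)=\varphi$ if $\varphi$ is $tt$, $f\!f$ or a literal; $t$ commutes with $\wedge,\vee$; $t(X\psi)=\neg Tail\wedge X\,t(\psi)$; $t(N\psi)=Tail\vee X\,t(\psi)$; $t(\psi_1 U\psi_2)=(\neg Tail\wedge t(\psi_1))\,U\,t(\psi_2)$; $t(\psi_1 R\psi_2)=(Tail\vee t(\psi_1))\,R\,t(\psi_2)$. For an arbitrary formula, $\mathrm{tnf}(\varphi)=t(\mathrm{nnf}(\varphi))\wedge(tt\,U\,Tail)$. *Next normal form.* $\mathrm{xnf}$ commutes with $\neg,\wedge,\vee$, fixes constants, atoms and next formulas, and $\mathrm{xnf}(\psi_1U\psi_2)=\mathrm{xnf}(\psi_2)\vee(\mathrm{xnf}(\psi_1)\wedge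 X(\psi_1U\psi_2))$, $\mathrm{xnf}(\psi_1R\psi_2)=\mathrm{xnf}(\psi_2)\wedge(\mathrm{xnf}(\psi_1)\vee X(\psi_1R\psi_2))$. For a finite set $s$ of formulas (a *state*, read as a conjunction), $\mathrm{xnf}(s)=\bigwedge_{\psi\in s}\mathrm{xnf}(\psi)$. For a formula $\alpha$, $\alpha^p$ is $\alpha$ read as a Boolean formula whose Boolean variables are the maximal subformulas of $\alpha$ that are atoms or have a temporal main operator. A model $A$ of $\alpha^p$ is an assignment to these variables that makes $\alpha^p$ true, and $X(A)=\{\theta : A \text{ makes } X\theta \text{ true}\}$. A state $s$ is *final* if $(Tail\wedge \mathrm{xnf}(s))^p$ is satisfiable. If $(\theta\wedge\mathrm{xnf}(s))^p$ is unsatisfiable, an *unsatisfiable core* (UC) of it is any $c\subseteq s$ such that $(\theta\wedge\mathrm{xnf}(c))^p$ is unsatisfiable. *Algorithm CDLSC* on an input formula $\phi$ over $P\cup\{Tail\}$. It maintains finite sets ("frames") $\mathcal C[0],\mathcal C[1],\dots$ of sets of formulas, initially all empty; $\mathcal C[i]$ stands for the formula $\bigvee_{c\in\mathcal C[i]}\bigwedge_{\psi\in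 c}\psi$, and $X(\mathcal C[i])=\bigvee_{c\in\mathcal C[i]}\bigwedge_{\psi\in c}X\psi$. 1. If $\{\phi\}$ is final, return SAT. Otherwise set $\mathcal C[0]:=\{\{\phi\}\}$ and $k:=0$. 2. Repeat: if $\mathit{try\_satisfy}(\{\phi\},k)$ is true, return SAT; if $\mathit{inv\_found}(k)$ is true, return UNSAT; otherwise set $k:=k+1$ and $\mathcal C[k]:=\emptyset$. $\mathit{try\_satisfy}(s,\ell)$: while $(\neg X(\mathcal C[\ell])\wedge\mathrm{xnf}(s))^p$ is satisfiable (for the current $\mathcal C[\ell]$), take a model $A$ and let $s'=X(A)$. If $\ell=0$: return true if $s'$ is final; otherwise add to $\mathcal C[0]$ a UC $c\subseteq s'$ of $(Tail\wedge\mathrm{xnf}(s'))^p$ and continue the loop. If $\ell>0$: return true if $\mathit{try\_satisfy}(s',\ell-1)$ is true, and continue the loop otherwise. When the loop condition fails, add a UC $c\subseteq s$ of $(\neg X(\mathcal C[\ell])\wedge\mathrm{xnf}(s))^p$ to $\mathcal C[\ell+1]$ and return false. $\mathit{inv\_found}(k)$ is true iff for some $0\le i\le k$ the Boolean formula $\bigl(\bigwedge_{0\le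 j\le i}\mathcal C[j]\Rightarrow\mathcal C[i+1]\bigr)^p$ is valid. All models and unsatisfiable cores are chosen arbitrarily. **Theorem.** Let $\varphi$ be an $\mathsf{LTL}_f$ formula and run CDLSC on the input $\mathrm{tnf}(\varphi)$. Whatever models and unsatisfiable cores are chosen, CDLSC terminates (there is no infinite run, and a run stops only by returning SAT or UNSAT), and its answer is correct: it is SAT if and only if $\varphi$ is satisfiable, equivalently if and only if $\mathrm{tnf}(\varphi)$ is satisfiable, and UNSAT if and only if $\varphi$ is unsatisfiable. -/

import Mathlib

namespace LTLf

/-- Formulas of linear temporal logic over finite traces, with atomic propositions in `α`.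
`next` is the strong next `X`, `wnext` its dual, the weak next `N`. -/
inductive Formula (α : Type*) where
  | tt : Formula α
  | ff : Formula α
  | atom : α → Formula α
  | neg : Formula α → Formula α
  | and : Formula α → Formula α → Formula α
  | or : Formula α → Formula α → Formula α
  | next : Formula α → Formula α
  | wnext : Formula α → Formula α
  | untl : Formula α → Formula α → Formula α
  | release : Formula α → Formula α → Formula α
  deriving DecidableEq

namespace Formula

/-! ### Semantics over finite traces -/

/-- `Holds w i φ`: the formula `φ` holds at position `i` of the finite trace `w`
(each letter of the trace is the set of atomic propositions that are true there). -/
def Holds {α : Type*} (w : List (Set α)) : ℕ → Formula α → Prop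
  | _, tt => True
  | _, ff => False
  | i, atom p => ∃ σ : Set α, w[i]? = some σ ∧ p ∈ σ
  | i, neg φ => ¬ Holds w i φ
  | i, and φ ψ => Holds w i φ ∧ Holds w i ψ
  | i, or φ ψ => Holds w i φ ∨ Holds w i ψ
  | i, next φ => i + 1 < w.length ∧ Holds w (i + 1) φ
  | i, wnext φ => i + 1 < w.length → Holds w (i + 1) φ
  | i, untl φ ψ =>
      ∃ k, i ≤ k ∧ k < w.length ∧ Holds w k ψ ∧ ∀ j, i ≤ j → j < k → Holds w j φ
  | i, release φ ψ =>
      ∀ k, i ≤ k → k < w.length → Holds w k ψ ∨ ∃ j, i ≤ j ∧ j < k ∧ Holds w j φ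

/-- `φ` is satisfiable: some nonempty finite trace satisfies it at its first position. -/
def Satisfiable {α : Type*} (φ : Formula α) : Prop :=
  ∃ w : List (Set α), w ≠ [] ∧ Holds w 0 φ

/-! ### Normal forms -/

/-- `nnf true φ` is the negation normal form of `φ`, and `nnf false φ` that of `¬ φ`. -/
def nnf {α : Type*} : Bool → Formula α → Formula α
  | true, tt => tt
  | false, tt => ff
  | true, ff => ff
  | false, ff => tt
  | true, atom p => atom p
  | false, atom p => neg (atom p)
  | b, neg φ => nnf (!b) φ
  | true, and φ ψ => and (nnf true φ) (nnf true ψ)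
  | false, and φ ψ => or (nnf false φ) (nnf false ψ)
  | true, or φ ψ => or (nnf true φ) (nnf true ψ)
  | false, or φ ψ => and (nnf false φ) (nnf false ψ)
  | true, next φ => next (nnf true φ)
  | false, next φ => wnext (nnf false φ)
  | true, wnext φ => wnext (nnf true φ)
  | false, wnext φ => next (nnf false φ)
  | true, untl φ ψ => untl (nnf true φ) (nnf true ψ)
  | false, untl φ ψ => release (nnf false φ) (nnf false ψ)
  | true, release φ ψ => release (nnf true φ) (nnf true ψ)
  | false, release φ ψ => untl (nnf false φ) (nnf false ψ)

/-- The new atom `Tail`, which marks the last position; the atoms of the original formula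
become `some p`. -/
def tail {α : Type*} : Formula (Option α) := atom none

/-- The recursive part of the tail normal form. It is applied to formulas in negation normal
form, so `neg` is met only in front of an atom. -/
def tailForm {α : Type*} : Formula α → Formula (Option α)
  | tt => tt
  | ff => ff
  | atom p => atom (some p)
  | neg φ => neg (tailForm φ)
  | and φ ψ => and (tailForm φ) (tailForm ψ)
  | or φ ψ => or (tailForm φ) (tailForm ψ)
  | next φ => and (neg tail) (next (tailForm φ))
  | wnext φ => or tail (next (tailForm φ))
  | untl φ ψ => untl (and (neg tail) (tailForm φ)) (tailForm ψ)
  | release φ ψ => release (or tail (tailForm φ)) (tailForm ψ)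

/-- The tail normal form of `φ`, namely `t(nnf φ) ∧ F Tail`, where `F Tail = tt U Tail`. -/
def tnf {α : Type*} (φ : Formula α) : Formula (Option α) :=
  and (tailForm (nnf true φ)) (untl tt tail)

/-- The next normal form: until and release are unfolded once. (The operator `wnext` does not
occur in a tail normal form.) -/
def xnf {α : Type*} : Formula α → Formula α
  | tt => tt
  | ff => ff
  | atom p => atom p
  | neg φ => neg (xnf φ)
  | and φ ψ => and (xnf φ) (xnf ψ)
  | or φ ψ => or (xnf φ) (xnf ψ)
  | next φ => next φ
  | wnext φ => wnext φ
  | untl φ ψ => or (xnf ψ) (and (xnf φ) (next (untl φ ψ)))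
  | release φ ψ => and (xnf ψ) (or (xnf φ) (next (release φ ψ)))

/-! ### The Boolean formula `φᵖ` -/

/-- The atoms of the Boolean formula `φᵖ`: the maximal subformulas of `φ` that are
atomic propositions or have a temporal main operator. -/
def propAtoms {α : Type*} [DecidableEq α] : Formula α → Finset (Formula α)
  | tt => ∅
  | ff => ∅
  | atom p => {atom p}
  | neg φ => propAtoms φ
  | and φ ψ => propAtoms φ ∪ propAtoms ψ
  | or φ ψ => propAtoms φ ∪ propAtoms ψ
  | next φ => {next φ}
  | wnext φ => {wnext φ}
  | untl φ ψ => {untl φ ψ}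
  | release φ ψ => {release φ ψ}

/-- The truth value of `φᵖ` under the assignment whose true atoms are those in `A`. -/
def PropEval {α : Type*} (A : Finset (Formula α)) : Formula α → Prop
  | tt => True
  | ff => False
  | atom p => atom p ∈ A
  | neg φ => ¬ PropEval A φ
  | and φ ψ => PropEval A φ ∧ PropEval A ψ
  | or φ ψ => PropEval A φ ∨ PropEval A ψ
  | next φ => next φ ∈ A
  | wnext φ => wnext φ ∈ A
  | untl φ ψ => untl φ ψ ∈ A
  | release φ ψ => release φ ψ ∈ A

/-- `A` is (the set of true atoms of) a model of the Boolean formula `φᵖ`. -/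
def IsPropModel {α : Type*} [DecidableEq α] (A : Finset (Formula α)) (φ : Formula α) : Prop :=
  A ⊆ propAtoms φ ∧ PropEval A φ

/-- The Boolean formula `φᵖ` is satisfiable. -/
def PropSat {α : Type*} [DecidableEq α] (φ : Formula α) : Prop :=
  ∃ A, IsPropModel A φ

/-- Conjunction and disjunction of a list of formulas. -/
def listAnd {α : Type*} (l : List (Formula α)) : Formula α := l.foldr and tt

def listOr {α : Type*} (l : List (Formula α)) : Formula α := l.foldr or ff

end Formula

open Formula

/-! ### States and frames -/

/-- A state of the transition system: a finite set of formulas, read as their conjunction. -/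
abbrev State (α : Type*) := Finset (Formula α)

/-- A frame: a finite set of sets of formulas. -/
abbrev Frame (α : Type*) := Finset (Finset (Formula α))

/-- `xnf(s) = ⋀_{ψ ∈ s} xnf(ψ)`. -/
noncomputable def State.xnf {α : Type*} (s : State α) : Formula α :=
  listAnd (s.toList.map Formula.xnf)

/-- The formula `⋁_{c ∈ F} ⋀_{ψ ∈ c} ψ` of a frame `F`. -/
noncomputable def Frame.toFormula {α : Type*} (F : Frame α) : Formula α :=
  listOr (F.toList.map fun c => listAnd c.toList)

/-- The formula `X(F) = ⋁_{c ∈ F} ⋀_{ψ ∈ c} X ψ` of a frame `F`. -/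
noncomputable def Frame.nextFormula {α : Type*} (F : Frame α) : Formula α :=
  listOr (F.toList.map fun c => listAnd (c.toList.map Formula.next))

/-- `X(A) = {θ | X θ ∈ A}`, the next state extracted from an assignment `A`. -/
def nextState {α : Type*} [DecidableEq α] (A : Finset (Formula α)) : State α :=
  A.biUnion fun φ => match φ with
    | .next θ => {θ}
    | _ => ∅

/-- The Boolean formula that is sent to the SAT solver is `(θ ∧ xnf(s))ᵖ`. -/
noncomputable def query {α : Type*} (θ : Formula α) (s : State α) : Formula α :=
  Formula.and θ s.xnf

/-- `s` is a final state: `Tail ∧ xnf(s)ᵖ` is satisfiable. -/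
def IsFinal {α : Type*} [DecidableEq α] (s : State (Option α)) : Prop :=
  PropSat (query tail s)

/-- `c` is a possible answer of `get_uc` after the query `(θ ∧ xnf(s))ᵖ` was found
unsatisfiable: a subset of `s` for which the query is still unsatisfiable. -/
def IsUC {α : Type*} [DecidableEq α] (θ : Formula α) (s c : State α) : Prop :=
  c ⊆ s ∧ ¬ PropSat (query θ c)

/-- The frame sequence `𝒞`; frames that have not been created yet are empty. -/
abbrev Frames (α : Type*) := ℕ → Frame α

/-- Add `c` to the frame `𝒞[i]`. -/
def Frames.add {α : Type*} [DecidableEq α] (C : Frames α) (i : ℕ) (c : State α) : Frames α :=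
  Function.update C i (insert c (C i))

/-- `inv_found`: for some `i ≤ k` the Boolean formula
`(⋀_{0 ≤ j ≤ i} 𝒞[j] ⇒ 𝒞[i+1])ᵖ` is valid, i.e. its negation is unsatisfiable. -/
def InvFound {α : Type*} [DecidableEq α] (C : Frames α) (k : ℕ) : Prop :=
  ∃ i ≤ k, ¬ PropSat (Formula.and
    (listAnd ((List.range (i + 1)).map fun j => (C j).toFormula))
    (Formula.neg (C (i + 1)).toFormula))

/-! ### The algorithm CDLSC as a nondeterministic machine -/

/-- The answers of the algorithm. -/
inductive Answer where
  | SAT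
  | UNSAT
  deriving DecidableEq

/-- A pending call `try_satisfy(state, level)`. -/
structure Call (α : Type*) where
  state : State α
  level : ℕ

/-- Machine configurations; `k` is the variable `frame_level` of the main loop and `C` the
current frame sequence. The list in `run` and `ret` is the stack of suspended calls of
`try_satisfy`, the innermost first.
* `start`: at the beginning;
* `loop k C`: at the head of the main loop;
* `run f stack k C`: the call `f` of `try_satisfy` is at the head of its while loop;
* `ret b stack k C`: a call of `try_satisfy` has just returned `b`;
* `halt r`: the answer `r` has been returned. -/
inductive Config (α : Type*) where
  | start : Config α
  | loop (k : ℕ) (C : Frames α) : Config α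
  | run (f : Call α) (stack : List (Call α)) (k : ℕ) (C : Frames α) : Config α
  | ret (b : Bool) (stack : List (Call α)) (k : ℕ) (C : Frames α) : Config α
  | halt (r : Answer) : Config α

/-- One step of CDLSC on the input formula `φ`. The models and the unsatisfiable cores returned
by the SAT solver are arbitrary; this is the only source of nondeterminism. -/
inductive Step {α : Type*} [DecidableEq α] (φ : Formula (Option α)) :
    Config (Option α) → Config (Option α) → Prop
  /-- The initial state `{φ}` is final. -/
  | startSat (h : IsFinal {φ}) : Step φ .start (.halt .SAT)
  /-- Otherwise `𝒞[0] := {{φ}}` and `frame_level := 0`. -/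
  | startLoop (h : ¬ IsFinal {φ}) :
      Step φ .start (.loop 0 (Function.update (fun _ => ∅) 0 {{φ}}))
  /-- Call `try_satisfy(φ, frame_level)`. -/
  | call (k : ℕ) (C : Frames (Option α)) : Step φ (.loop k C) (.run ⟨{φ}, k⟩ [] k C)
  /-- Level 0: the next state that was found is final; return true. -/
  | found (s : State (Option α)) (stack : List (Call (Option α))) (k : ℕ)
      (C : Frames (Option α)) (A : Finset (Formula (Option α)))
      (hA : IsPropModel A (query (.neg (C 0).nextFormula) s))
      (hf : IsFinal (nextState A)) :
      Step φ (.run ⟨s, 0⟩ stack k C) (.ret true stack k C)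
  /-- Level 0: the next state that was found is not final; add a core to `𝒞[0]`, continue. -/
  | block (s : State (Option α)) (stack : List (Call (Option α))) (k : ℕ)
      (C : Frames (Option α)) (A : Finset (Formula (Option α))) (c : State (Option α))
      (hA : IsPropModel A (query (.neg (C 0).nextFormula) s))
      (hf : ¬ IsFinal (nextState A))
      (hc : IsUC tail (nextState A) c) :
      Step φ (.run ⟨s, 0⟩ stack k C) (.run ⟨s, 0⟩ stack k (C.add 0 c))
  /-- Positive level: recursive call of `try_satisfy` on the next state, one level below. -/
  | descend (s : State (Option α)) (l : ℕ) (stack : List (Call (Option α))) (k : ℕ)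
      (C : Frames (Option α)) (A : Finset (Formula (Option α)))
      (hA : IsPropModel A (query (.neg (C (l + 1)).nextFormula) s)) :
      Step φ (.run ⟨s, l + 1⟩ stack k C) (.run ⟨nextState A, l⟩ (⟨s, l + 1⟩ :: stack) k C)
  /-- No further next state: add a core to `𝒞[level + 1]` and return false. -/
  | exhausted (s : State (Option α)) (l : ℕ) (stack : List (Call (Option α))) (k : ℕ)
      (C : Frames (Option α)) (c : State (Option α))
      (hs : ¬ PropSat (query (.neg (C l).nextFormula) s))
      (hc : IsUC (.neg (C l).nextFormula) s c) :
      Step φ (.run ⟨s, l⟩ stack k C) (.ret false stack k (C.add (l + 1) c))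
  /-- A recursive call returned true: so does its caller. -/
  | retTrue (f : Call (Option α)) (stack : List (Call (Option α))) (k : ℕ)
      (C : Frames (Option α)) :
      Step φ (.ret true (f :: stack) k C) (.ret true stack k C)
  /-- A recursive call returned false: its caller continues its while loop. -/
  | retFalse (f : Call (Option α)) (stack : List (Call (Option α))) (k : ℕ)
      (C : Frames (Option α)) :
      Step φ (.ret false (f :: stack) k C) (.run f stack k C)
  /-- The outermost call returned true. -/
  | answerSat (k : ℕ) (C : Frames (Option α)) : Step φ (.ret true [] k C) (.halt .SAT)
  /-- The outermost call returned false and `inv_found(frame_level)` is true. -/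
  | answerUnsat (k : ℕ) (C : Frames (Option α)) (h : InvFound C k) :
      Step φ (.ret false [] k C) (.halt .UNSAT)
  /-- The outermost call returned false and `inv_found(frame_level)` is false:
  `frame_level := frame_level + 1` and `𝒞[frame_level] := ∅`. -/
  | newFrame (k : ℕ) (C : Frames (Option α)) (h : ¬ InvFound C k) :
      Step φ (.ret false [] k C) (.loop (k + 1) (Function.update C (k + 1) ∅))

/-- `c` can be reached by CDLSC on the input `φ`. -/
def Reachable {α : Type*} [DecidableEq α] (φ : Formula (Option α)) (c : Config (Option α)) :
    Prop :=
  Relation.ReflTransGen (Step φ) .start c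

end LTLf

/-! A trace satisfying `φ` becomes one of `tnf φ` by marking its last position with `Tail`, and a
trace of `tnf φ` becomes one of `φ` by cutting it at its first `Tail` (`holds_addTail`,
`holds_dropTail`). The guards on `Tail` then make the next normal form, which has only strong next,
faithful enough in both directions: truth implies `xnf` on traces with `Tail` exactly at the end
(`TailNormal.holds_xnf`), and a Boolean model of `xnf` yields a real letter, put in front of a trace
of its next state or standing alone when `Tail` is true (`holds_of_propEval_xnf`,
`holds_singleton_of_propEval_xnf`).

SAT is sound because satisfiability passes from a final state back along the chain of calls to the
input. UNSAT is sound because members of `C 0` are not final, successors of members of `C (l + 1)`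
are covered by `C l`, and successors of the input are covered by every `C j` with `j ≤ k`. If the
first `i + 1` frames together imply the next one, their conjunction is an inductive invariant of all
positions after the first on any marked trace of the input. It includes `C 0` at the last position,
which is impossible (`not_holds_of_invFound`).

For termination, all states and cores lie in a finite closure `cl`. While no invariant is found, the
sets of assignments satisfying `C 0, …, C i` shrink strictly with `i`, which bounds the number of
rounds (`lt_of_not_invFound`). Within a round every core put into `C 0, …, C k` is new, because a
model falsifies `X(C l)` and so yields a state containing no old core. Between two such additions,
calls only descend, return or resume. A lexicographic measure combines these facts in
`Step.inv_and_measure_lt`. -/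

namespace LTLf

open Formula

namespace Formula

variable {α : Type*}

/-! ### Boolean evaluation -/

theorem propEval_congr [DecidableEq α] {A B : Finset (Formula α)} {χ : Formula α}
    (h : ∀ a ∈ propAtoms χ, a ∈ A ↔ a ∈ B) : PropEval A χ ↔ PropEval B χ := by
  induction χ with
  | tt | ff => simp [PropEval]
  | neg φ ih => simp only [PropEval, ih h]
  | and φ ψ ih₁ ih₂ | or φ ψ ih₁ ih₂ =>
    simp only [propAtoms, Finset.mem_union] at h
    simp only [PropEval, ih₁ fun a ha => h a (.inl ha), ih₂ fun a ha => h a (.inr ha)]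
  | _ => exact h _ (by simp [propAtoms])

theorem propSat_iff [DecidableEq α] {χ : Formula α} : PropSat χ ↔ ∃ A, PropEval A χ := by
  constructor
  · rintro ⟨A, -, h⟩
    exact ⟨A, h⟩
  · rintro ⟨A, h⟩
    refine ⟨A ∩ propAtoms χ, Finset.inter_subset_right, ?_⟩
    exact (propEval_congr fun a ha => by simp [ha]).2 h

/-- Boolean variables, temporal ones included, take their values from a position of the trace. This
turns each unsatisfiable query into a fact about all traces. -/
theorem propEval_iff_holds [DecidableEq α] {w : List (Set α)} {i : ℕ} {A : Finset (Formula α)}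
    {χ : Formula α} (h : ∀ a ∈ propAtoms χ, a ∈ A ↔ Holds w i a) :
    PropEval A χ ↔ Holds w i χ := by
  induction χ with
  | tt | ff => simp [PropEval, Holds]
  | neg φ ih => simp only [PropEval, Holds, ih h]
  | and φ ψ ih₁ ih₂ | or φ ψ ih₁ ih₂ =>
    simp only [propAtoms, Finset.mem_union] at h
    simp only [PropEval, Holds, ih₁ fun a ha => h a (.inl ha), ih₂ fun a ha => h a (.inr ha)]
  | _ => exact h _ (by simp [propAtoms])

open Classical in
theorem exists_propEval_iff_holds [DecidableEq α] (w : List (Set α)) (i : ℕ) (χ : Formula α) :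
    ∃ A : Finset (Formula α), PropEval A χ ↔ Holds w i χ :=
  ⟨(propAtoms χ).filter (Holds w i ·), propEval_iff_holds fun a ha => by simp [ha]⟩

theorem propSat_of_holds [DecidableEq α] {w : List (Set α)} {i : ℕ} {χ : Formula α}
    (h : Holds w i χ) : PropSat χ := by
  obtain ⟨A, hA⟩ := exists_propEval_iff_holds w i χ
  exact propSat_iff.2 ⟨A, hA.2 h⟩

theorem propEval_listAnd {A : Finset (Formula α)} {l : List (Formula α)} :
    PropEval A (listAnd l) ↔ ∀ χ ∈ l, PropEval A χ := by
  induction l with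
  | nil => simp [listAnd, PropEval]
  | cons a l ih => simpa [listAnd, PropEval] using fun _ => ih

theorem propEval_listOr {A : Finset (Formula α)} {l : List (Formula α)} :
    PropEval A (listOr l) ↔ ∃ χ ∈ l, PropEval A χ := by
  induction l with
  | nil => simp [listOr, PropEval]
  | cons a l ih => simpa [listOr, PropEval] using or_congr_right ih

theorem holds_listAnd {w : List (Set α)} {i : ℕ} {l : List (Formula α)} :
    Holds w i (listAnd l) ↔ ∀ χ ∈ l, Holds w i χ := by
  induction l with
  | nil => simp [listAnd, Holds]
  | cons a l ih => simpa [listAnd, Holds] using fun _ => ih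

theorem holds_listOr {w : List (Set α)} {i : ℕ} {l : List (Formula α)} :
    Holds w i (listOr l) ↔ ∃ χ ∈ l, Holds w i χ := by
  induction l with
  | nil => simp [listOr, Holds]
  | cons a l ih => simpa [listOr, Holds] using or_congr_right ih

theorem mem_propAtoms_listAnd [DecidableEq α] {a : Formula α} {l : List (Formula α)} :
    a ∈ propAtoms (listAnd l) ↔ ∃ χ ∈ l, a ∈ propAtoms χ := by
  induction l with
  | nil => simp [listAnd, propAtoms]
  | cons b l ih => simpa [listAnd, propAtoms] using or_congr_right ih

theorem mem_propAtoms_listOr [DecidableEq α] {a : Formula α} {l : List (Formula α)} :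
    a ∈ propAtoms (listOr l) ↔ ∃ χ ∈ l, a ∈ propAtoms χ := by
  induction l with
  | nil => simp [listOr, propAtoms]
  | cons b l ih => simpa [listOr, propAtoms] using or_congr_right ih

end Formula

/-! ### States, frames and next states. -/

section States

variable {α : Type*}

theorem propEval_state_xnf {A : Finset (Formula α)} {s : State α} :
    PropEval A s.xnf ↔ ∀ θ ∈ s, PropEval A θ.xnf := by
  simp [State.xnf, propEval_listAnd]

theorem holds_state_xnf {w : List (Set α)} {i : ℕ} {s : State α} :
    Holds w i s.xnf ↔ ∀ θ ∈ s, Holds w i θ.xnf := by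
  simp [State.xnf, holds_listAnd]

theorem propEval_nextFormula {A : Finset (Formula α)} {F : Frame α} :
    PropEval A F.nextFormula ↔ ∃ c ∈ F, ∀ θ ∈ c, θ.next ∈ A := by
  simp [Frame.nextFormula, propEval_listOr, propEval_listAnd, PropEval]

theorem holds_nextFormula {w : List (Set α)} {i : ℕ} {F : Frame α} :
    Holds w i F.nextFormula ↔ ∃ c ∈ F, ∀ θ ∈ c, Holds w i θ.next := by
  simp [Frame.nextFormula, holds_listOr, holds_listAnd]

theorem propEval_toFormula {A : Finset (Formula α)} {F : Frame α} :
    PropEval A F.toFormula ↔ ∃ c ∈ F, ∀ θ ∈ c, PropEval A θ := by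
  simp [Frame.toFormula, propEval_listOr, propEval_listAnd]

theorem holds_toFormula {w : List (Set α)} {i : ℕ} {F : Frame α} :
    Holds w i F.toFormula ↔ ∃ c ∈ F, ∀ θ ∈ c, Holds w i θ := by
  simp [Frame.toFormula, holds_listOr, holds_listAnd]

theorem mem_nextState [DecidableEq α] {A : Finset (Formula α)} {θ : Formula α} :
    θ ∈ nextState A ↔ θ.next ∈ A := by
  simp only [nextState, Finset.mem_biUnion]
  constructor
  · rintro ⟨χ, hχ, h⟩
    cases χ <;> simp_all
  · intro h
    exact ⟨_, h, by simp⟩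

/-- The model falsifies `X(F)`, so no old core fits inside the next state. This makes every blocking
core new, which drives termination. -/
theorem not_subset_nextState [DecidableEq α] {A : Finset (Formula α)} {F : Frame α} {s c : State α}
    (hA : IsPropModel A (query (.neg F.nextFormula) s)) (hc : c ⊆ nextState A) : c ∉ F :=
  fun h => hA.2.1 (propEval_nextFormula.2 ⟨c, h, fun _ hθ => mem_nextState.1 (hc hθ)⟩)

/-- A larger frame only strengthens the negated conjunct, so established covering survives the
growth of frames. -/
theorem propSat_query_neg_nextFormula_anti [DecidableEq α] {F G : Frame α} (h : F ⊆ G)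
    {c : State α} (hc : PropSat (query (.neg G.nextFormula) c)) :
    PropSat (query (.neg F.nextFormula) c) := by
  obtain ⟨A, h₁, h₂⟩ := propSat_iff.1 hc
  refine propSat_iff.2 ⟨A, fun h₃ => h₁ ?_, h₂⟩
  obtain ⟨d, hd, h₃⟩ := propEval_nextFormula.1 h₃
  exact propEval_nextFormula.2 ⟨d, h hd, h₃⟩

end States

namespace Formula

variable {α : Type*}

/-! ### Correctness of the tail normal form -/

theorem holds_nnf (w : List (Set α)) (φ : Formula α) (i : ℕ) :
    (Holds w i (nnf true φ) ↔ Holds w i φ) ∧ (Holds w i (nnf false φ) ↔ ¬ Holds w i φ) := by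
  induction φ generalizing i with
  | tt | ff | atom p => simp [nnf, Holds]
  | neg φ ih => simp [nnf, Holds, ih]
  | and φ ψ ih₁ ih₂ | or φ ψ ih₁ ih₂ =>
    simp only [nnf, Holds, ih₁, ih₂]
    tauto
  | next φ ih | wnext φ ih =>
    simp only [nnf, Holds, ih]
    tauto
  | untl φ ψ ih₁ ih₂ | release φ ψ ih₁ ih₂ =>
    simp only [nnf, Holds, ih₁, ih₂]
    push Not
    grind

/-- Formulas in negation normal form. -/
inductive IsNNF : Formula α → Prop
  | tt : IsNNF tt
  | ff : IsNNF ff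
  | atom (p : α) : IsNNF (atom p)
  | negAtom (p : α) : IsNNF (neg (atom p))
  | and {φ ψ : Formula α} : IsNNF φ → IsNNF ψ → IsNNF (and φ ψ)
  | or {φ ψ : Formula α} : IsNNF φ → IsNNF ψ → IsNNF (or φ ψ)
  | next {φ : Formula α} : IsNNF φ → IsNNF (next φ)
  | wnext {φ : Formula α} : IsNNF φ → IsNNF (wnext φ)
  | untl {φ ψ : Formula α} : IsNNF φ → IsNNF ψ → IsNNF (untl φ ψ)
  | release {φ ψ : Formula α} : IsNNF φ → IsNNF ψ → IsNNF (release φ ψ)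

theorem isNNF_nnf (b : Bool) (φ : Formula α) : IsNNF (nnf b φ) := by
  induction φ generalizing b with
  | neg φ ih => cases b <;> exact ih _
  | _ => cases b <;> simp only [nnf] <;> constructor <;> solve_by_elim

/-- `Tail` holds exactly at the last position of `w`. -/
def TailAtEnd (w : List (Set (Option α))) : Prop :=
  ∀ i < w.length, Holds w i tail ↔ i + 1 = w.length

/-- The trace `w` with `Tail` added at its last position. -/
def addTail (w : List (Set α)) : List (Set (Option α)) :=
  w.mapIdx fun i σ => {x | (∃ p ∈ σ, x = some p) ∨ (x = none ∧ i + 1 = w.length)}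

theorem length_addTail (w : List (Set α)) : (addTail w).length = w.length := by
  simp [addTail]

theorem tailAtEnd_addTail (w : List (Set α)) : TailAtEnd (addTail w) := by
  intro i hi
  rw [length_addTail] at hi ⊢
  simp [tail, Holds, addTail, hi]

/-- One implication suffices for the induction, because negation occurs only in front of atoms. -/
theorem holds_addTail {w : List (Set α)} {φ : Formula α} (hφ : IsNNF φ) {i : ℕ}
    (hi : i < w.length) (h : Holds w i φ) : Holds (addTail w) i (tailForm φ) := by
  have htail : ∀ j < w.length, Holds (addTail w) j tail ↔ j + 1 = w.length := by
    simpa [TailAtEnd, length_addTail] using tailAtEnd_addTail w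
  induction hφ generalizing i with
  | tt | ff => exact h
  | atom p | negAtom p => simpa [tailForm, Holds, addTail, hi] using h
  | and _ _ ih₁ ih₂ => exact ⟨ih₁ hi h.1, ih₂ hi h.2⟩
  | or _ _ ih₁ ih₂ => exact h.imp (ih₁ hi) (ih₂ hi)
  | next _ ih =>
    refine ⟨?_, by simpa [length_addTail] using h.1, ih h.1 h.2⟩
    have := h.1
    simp only [Holds, htail i hi]
    lia
  | wnext _ ih =>
    by_cases hl : i + 1 < w.length
    · exact .inr ⟨by simpa [length_addTail] using hl, ih hl (h hl)⟩
    · exact .inl ((htail i hi).2 (by lia))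
  | untl _ _ ih₁ ih₂ =>
    obtain ⟨k, hik, hk, h₁, h₂⟩ := h
    refine ⟨k, hik, by simpa [length_addTail] using hk, ih₂ hk h₁, fun j hij hjk =>
      ⟨?_, ih₁ (by lia) (h₂ j hij hjk)⟩⟩
    simp only [Holds, htail j (by lia)]
    lia
  | release _ _ ih₁ ih₂ =>
    intro k hik hk
    rw [length_addTail] at hk
    refine (h k hik hk).imp (ih₂ hk) ?_
    rintro ⟨j, hij, hjk, hj⟩
    exact ⟨j, hij, hjk, .inr (ih₁ (by lia) hj)⟩

theorem exists_tailAtEnd_of_satisfiable {φ : Formula α} (h : φ.Satisfiable) :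
    ∃ w : List (Set (Option α)), w ≠ [] ∧ TailAtEnd w ∧ Holds w 0 φ.tnf := by
  obtain ⟨w, hw, h⟩ := h
  have hpos : 0 < w.length := List.length_pos_iff.2 hw
  refine ⟨addTail w, ?_, tailAtEnd_addTail w,
    holds_addTail (isNNF_nnf _ _) hpos ((holds_nnf w φ 0).1.2 h), w.length - 1, ?_, ?_, ?_, ?_⟩
  · rw [← List.length_pos_iff, length_addTail]
    exact hpos
  · lia
  · rw [length_addTail]
    lia
  · rw [tailAtEnd_addTail w _ (by rw [length_addTail]; lia), length_addTail]
    lia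
  · intros
    trivial

/-- The first `n + 1` letters of `w`, without `Tail`. -/
def dropTail (w : List (Set (Option α))) (n : ℕ) : List (Set α) :=
  (w.take (n + 1)).map fun σ => {p | some p ∈ σ}

/-- The guards keep all evidence within the cut: no strong next or until can pass the first `Tail`
at `n`, and before `n` the disjunct `Tail` of weak next and release is false. -/
theorem holds_dropTail {w : List (Set (Option α))} {n : ℕ} (hn : n < w.length)
    (hlt : ∀ i < n, ¬ Holds w i tail) (htail : Holds w n tail) {φ : Formula α} (hφ : IsNNF φ)
    {i : ℕ} (hi : i ≤ n) (h : Holds w i (tailForm φ)) : Holds (dropTail w n) i φ := by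
  have hlen : (dropTail w n).length = n + 1 := by
    simp [dropTail]
    lia
  induction hφ generalizing i with
  | tt | ff => exact h
  | atom p | negAtom p =>
    have : i < w.length := by lia
    simpa [tailForm, Holds, dropTail, this, List.getElem?_take, Nat.lt_succ_of_le hi] using h
  | and _ _ ih₁ ih₂ => exact ⟨ih₁ hi h.1, ih₂ hi h.2⟩
  | or _ _ ih₁ ih₂ => exact h.imp (ih₁ hi) (ih₂ hi)
  | next _ ih =>
    have : i ≠ n := by
      rintro rfl
      exact h.1 htail
    exact ⟨by lia, ih (by lia) h.2.2⟩
  | wnext _ ih =>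
    intro hl
    exact ih (by lia) ((h.resolve_left (hlt i (by lia))).2)
  | untl _ _ ih₁ ih₂ =>
    obtain ⟨k, hik, hk, h₁, h₂⟩ := h
    have hkn : k ≤ n := by
      by_contra hkn
      exact (h₂ n hi (by lia)).1 htail
    exact ⟨k, hik, by lia, ih₂ hkn h₁, fun j hij hjk => ih₁ (by lia) (h₂ j hij hjk).2⟩
  | release _ _ ih₁ ih₂ =>
    intro k hik hk
    refine (h k hik (by lia)).imp (ih₂ (by lia)) ?_
    rintro ⟨j, hij, hjk, hj⟩
    exact ⟨j, hij, hjk, ih₁ (by lia) (hj.resolve_left (hlt j (by lia)))⟩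

open Classical in
theorem satisfiable_of_satisfiable_tnf {φ : Formula α} (h : φ.tnf.Satisfiable) :
    φ.Satisfiable := by
  obtain ⟨w, -, h₁, k, -, hk, h₂, -⟩ := h
  -- The conjunct `tt U Tail` guarantees a `Tail`; the first one is the place to cut.
  have hex : ∃ n, Holds w n tail := ⟨k, h₂⟩
  have hle : Nat.find hex ≤ k := Nat.find_min' hex h₂
  have := holds_dropTail (by lia) (fun i hi => Nat.find_min hex hi) (Nat.find_spec hex)
    (isNNF_nnf true φ) (Nat.zero_le _) h₁
  refine ⟨_, ?_, (holds_nnf _ φ 0).1.1 this⟩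
  rw [← List.length_pos_iff]
  simp [dropTail]
  lia

/-! ### Formulas in tail normal form -/

/-- The shape of the formulas in the states of the transition system of a tail normal form. -/
inductive TailNormal : Formula (Option α) → Prop
  | tt : TailNormal tt
  | ff : TailNormal ff
  | atom (p : Option α) : TailNormal (atom p)
  | negAtom (p : Option α) : TailNormal (neg (atom p))
  | and {φ ψ : Formula (Option α)} : TailNormal φ → TailNormal ψ → TailNormal (and φ ψ)
  | or {φ ψ : Formula (Option α)} : TailNormal φ → TailNormal ψ → TailNormal (or φ ψ)
  | next {φ : Formula (Option α)} : TailNormal φ → TailNormal (and (neg tail) (next φ))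
  | wnext {φ : Formula (Option α)} : TailNormal φ → TailNormal (or tail (next φ))
  | untl {φ ψ : Formula (Option α)} : TailNormal φ → TailNormal ψ →
      TailNormal (untl (and (neg tail) φ) ψ)
  | release {φ ψ : Formula (Option α)} : TailNormal φ → TailNormal ψ →
      TailNormal (release (or tail φ) ψ)
  | eventuallyTail : TailNormal (untl tt tail)

theorem tailNormal_tnf (φ : Formula α) : TailNormal φ.tnf := by
  refine .and ?_ .eventuallyTail
  have h := isNNF_nnf true φ
  generalize nnf true φ = χ at h
  induction h with
  | tt => exact .tt
  | ff => exact .ff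
  | atom p => exact .atom _
  | negAtom p => exact .negAtom _
  | and _ _ ih₁ ih₂ => exact .and ih₁ ih₂
  | or _ _ ih₁ ih₂ => exact .or ih₁ ih₂
  | next _ ih => exact .next ih
  | wnext _ ih => exact .wnext ih
  | untl _ _ ih₁ ih₂ => exact .untl ih₁ ih₂
  | release _ _ ih₁ ih₂ => exact .release ih₁ ih₂

theorem TailNormal.of_mem_propAtoms_xnf [DecidableEq α] {θ χ : Formula (Option α)}
    (hθ : TailNormal θ) (h : χ.next ∈ propAtoms θ.xnf) : TailNormal χ := by
  induction hθ with
  | tt | ff | atom p | negAtom p => simp [xnf, propAtoms] at h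
  | and _ _ ih₁ ih₂ | or _ _ ih₁ ih₂ =>
    simp only [xnf, propAtoms, Finset.mem_union] at h
    exact h.elim ih₁ ih₂
  | next hφ ih | wnext hφ ih =>
    simp [xnf, propAtoms, tail] at h
    exact h ▸ hφ
  | untl h₁ h₂ ih₁ ih₂ =>
    simp [xnf, propAtoms, tail] at h
    rcases h with rfl | h | h
    exacts [.untl h₁ h₂, ih₂ h, ih₁ h]
  | release h₁ h₂ ih₁ ih₂ =>
    simp [xnf, propAtoms, tail] at h
    rcases h with rfl | h | h
    exacts [.release h₁ h₂, ih₂ h, ih₁ h]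
  | eventuallyTail =>
    simp [xnf, propAtoms, tail] at h
    exact h ▸ .eventuallyTail

/-! ### Next normal forms and traces. -/

theorem holds_untl_unfold {w : List (Set α)} {i : ℕ} {φ ψ : Formula α} (hi : i < w.length) :
    Holds w i (untl φ ψ) ↔ Holds w i ψ ∨ (Holds w i φ ∧ Holds w i (next (untl φ ψ))) := by
  simp only [Holds]
  constructor
  · rintro ⟨k, hik, hk, h₁, h₂⟩
    rcases hik.eq_or_lt with rfl | hlt
    · exact .inl h₁
    · exact .inr ⟨h₂ i le_rfl hlt, by lia, k, hlt, hk, h₁, fun j hj => h₂ j (by lia)⟩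
  · rintro (h | ⟨h, -, k, hik, hk, h₁, h₂⟩)
    · exact ⟨i, le_rfl, hi, h, by lia⟩
    · refine ⟨k, by lia, hk, h₁, fun j hij hjk => ?_⟩
      rcases hij.eq_or_lt with rfl | hlt
      exacts [h, h₂ j hlt hjk]

/-- The exact unfolding needs a weak next, hence the disjunct for the last position, which `xnf`
lacks. -/
theorem holds_release_unfold {w : List (Set α)} {i : ℕ} {φ ψ : Formula α} (hi : i < w.length) :
    Holds w i (release φ ψ) ↔
      Holds w i ψ ∧ (Holds w i φ ∨ i + 1 = w.length ∨ Holds w i (next (release φ ψ))) := by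
  simp only [Holds]
  constructor
  · intro h
    refine ⟨(h i le_rfl hi).resolve_right (by rintro ⟨j, h₁, h₂, -⟩; lia), ?_⟩
    by_cases hφ : Holds w i φ
    · exact .inl hφ
    by_cases hl : i + 1 = w.length
    · exact .inr (.inl hl)
    refine .inr (.inr ⟨by lia, fun k hik hk => (h k (by lia) hk).imp_right ?_⟩)
    rintro ⟨j, hij, hjk, hj⟩
    rcases hij.eq_or_lt with rfl | hlt
    exacts [absurd hj hφ, ⟨j, hlt, hjk, hj⟩]
  · rintro ⟨hψ, h⟩ k hik hk
    rcases hik.eq_or_lt with rfl | hlt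
    · exact .inl hψ
    rcases h with h | h | ⟨-, h⟩
    · exact .inr ⟨i, le_rfl, hlt, h⟩
    · lia
    · refine (h k hlt hk).imp_right ?_
      rintro ⟨j, hij, hjk, hj⟩
      exact ⟨j, by lia, hjk, hj⟩

/-- On a trace that ends at its first `Tail`, the next normal form is a consequence. -/
theorem TailNormal.holds_xnf {w : List (Set (Option α))} (hw : TailAtEnd w)
    {θ : Formula (Option α)} (hθ : TailNormal θ) {i : ℕ} (hi : i < w.length)
    (h : Holds w i θ) : Holds w i θ.xnf := by
  induction hθ with
  | tt | ff | atom p | negAtom p | next _ _ | wnext _ _ => exact h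
  | and _ _ ih₁ ih₂ => exact ⟨ih₁ h.1, ih₂ h.2⟩
  | or _ _ ih₁ ih₂ => exact h.imp ih₁ ih₂
  | untl _ _ ih₁ ih₂ =>
    exact ((holds_untl_unfold hi).1 h).imp ih₂ fun h => ⟨⟨h.1.1, ih₁ h.1.2⟩, h.2⟩
  | release _ _ ih₁ ih₂ =>
    obtain ⟨h₁, h₂⟩ := (holds_release_unfold hi).1 h
    refine ⟨ih₂ h₁, ?_⟩
    rcases h₂ with h₂ | h₂ | h₂
    · exact .inl (h₂.imp_right ih₁)
    -- At the last position the guard `Tail` of the release replaces the missing weak next.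
    · exact .inl (.inl ((hw i hi).2 h₂))
    · exact .inr h₂
  | eventuallyTail => exact (holds_untl_unfold hi).1 h

/-- The letter of an assignment. -/
def letter (A : Finset (Formula α)) : Set α := {p | atom p ∈ A}

theorem holds_cons_succ (σ : Set α) (w : List (Set α)) (φ : Formula α) (i : ℕ) :
    Holds (σ :: w) (i + 1) φ ↔ Holds w i φ := by
  induction φ generalizing i with
  | tt | ff | atom p => simp [Holds]
  | neg φ ih => simp only [Holds, ih]
  | and φ ψ ih₁ ih₂ | or φ ψ ih₁ ih₂ => simp only [Holds, ih₁, ih₂]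
  | next φ ih | wnext φ ih => simp [Holds, ih]
  | untl φ ψ ih₁ ih₂ =>
    simp only [Holds]
    constructor
    · rintro ⟨k, hik, hk, h₁, h₂⟩
      obtain ⟨k, rfl⟩ : ∃ m, k = m + 1 := ⟨k - 1, by lia⟩
      exact ⟨k, by lia, by simpa using hk, (ih₂ k).1 h₁, fun j hij hjk =>
        (ih₁ j).1 (h₂ (j + 1) (by lia) (by lia))⟩
    · rintro ⟨k, hik, hk, h₁, h₂⟩
      refine ⟨k + 1, by lia, by simpa using hk, (ih₂ k).2 h₁, fun j hij hjk => ?_⟩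
      obtain ⟨j, rfl⟩ : ∃ m, j = m + 1 := ⟨j - 1, by lia⟩
      exact (ih₁ j).2 (h₂ j (by lia) (by lia))
  | release φ ψ ih₁ ih₂ =>
    simp only [Holds]
    constructor
    · intro h k hik hk
      refine (h (k + 1) (by lia) (by simpa using hk)).imp (ih₂ k).1 ?_
      rintro ⟨j, hij, hjk, hj⟩
      obtain ⟨j, rfl⟩ : ∃ m, j = m + 1 := ⟨j - 1, by lia⟩
      exact ⟨j, by lia, by lia, (ih₁ j).1 hj⟩
    · intro h k hik hk
      obtain ⟨k, rfl⟩ : ∃ m, k = m + 1 := ⟨k - 1, by lia⟩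
      refine (h k (by lia) (by simpa using hk)).imp (ih₂ k).2 ?_
      rintro ⟨j, hij, hjk, hj⟩
      exact ⟨j + 1, by lia, by lia, (ih₁ j).2 hj⟩

theorem holds_atom_letter_cons {A : Finset (Formula α)} {w : List (Set α)} {p : α} :
    Holds (letter A :: w) 0 (atom p) ↔ atom p ∈ A := by
  simp [Holds, letter]

theorem holds_next_cons {σ : Set α} {w : List (Set α)} {φ : Formula α} (hw : w ≠ [])
    (h : Holds w 0 φ) : Holds (σ :: w) 0 (next φ) :=
  ⟨by simpa [List.length_pos_iff] using hw, (holds_cons_succ σ w φ 0).2 h⟩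

/-- Next formulas occur only positively, so only those true in `A` have to be realised by `w`;
nothing is required of those that `A` makes false. -/
theorem TailNormal.holds_of_propEval_xnf {A : Finset (Formula (Option α))}
    {w : List (Set (Option α))} (hw : w ≠ []) (hA : ∀ χ, Formula.next χ ∈ A → Holds w 0 χ)
    {θ : Formula (Option α)} (hθ : TailNormal θ) (h : PropEval A θ.xnf) :
    Holds (letter A :: w) 0 θ := by
  have hlen : 0 < (letter A :: w).length := by simp
  have hX : ∀ χ, Formula.next χ ∈ A → Holds (letter A :: w) 0 (Formula.next χ) :=
    fun χ hχ => holds_next_cons hw (hA χ hχ)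
  induction hθ with
  | tt | ff => exact h
  | atom p => exact holds_atom_letter_cons.2 h
  | negAtom p => exact fun h' => h (holds_atom_letter_cons.1 h')
  | and _ _ ih₁ ih₂ => exact ⟨ih₁ h.1, ih₂ h.2⟩
  | or _ _ ih₁ ih₂ => exact h.imp ih₁ ih₂
  | next _ _ => exact ⟨fun h' => h.1 (holds_atom_letter_cons.1 h'), hX _ h.2⟩
  | wnext _ _ => exact h.imp holds_atom_letter_cons.2 (hX _)
  | untl _ _ ih₁ ih₂ =>
    exact (holds_untl_unfold hlen).2 (h.imp ih₂ fun h =>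
      ⟨⟨fun h' => h.1.1 (holds_atom_letter_cons.1 h'), ih₁ h.1.2⟩, hX _ h.2⟩)
  | release _ _ ih₁ ih₂ =>
    exact (holds_release_unfold hlen).2 ⟨ih₂ h.1, h.2.imp
      (fun h => h.imp holds_atom_letter_cons.2 ih₁) fun h => .inr (hX _ h)⟩
  | eventuallyTail =>
    exact (holds_untl_unfold hlen).2 (h.imp holds_atom_letter_cons.2 fun h => ⟨trivial, hX _ h.2⟩)

/-- With `Tail` true, guarded strong next and the deferred branch of a guarded until are
contradictory, while weak next and the left side of a release hold for free. Hence the next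
variables that `A` makes true need no successor. -/
theorem TailNormal.holds_singleton_of_propEval_xnf {A : Finset (Formula (Option α))}
    (hA : tail ∈ A) {θ : Formula (Option α)} (hθ : TailNormal θ) (h : PropEval A θ.xnf) :
    Holds [letter A] 0 θ := by
  have hlen : 0 < [letter A].length := by simp
  induction hθ with
  | tt | ff => exact h
  | atom p => exact holds_atom_letter_cons.2 h
  | negAtom p => exact fun h' => h (holds_atom_letter_cons.1 h')
  | and _ _ ih₁ ih₂ => exact ⟨ih₁ h.1, ih₂ h.2⟩
  | or _ _ ih₁ ih₂ => exact h.imp ih₁ ih₂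
  | next _ _ => exact absurd hA h.1
  | wnext _ _ => exact .inl (holds_atom_letter_cons.2 hA)
  | untl _ _ ih₁ ih₂ =>
    exact (holds_untl_unfold hlen).2 (h.imp ih₂ fun h => absurd hA h.1.1)
  | release _ _ ih₁ ih₂ =>
    exact (holds_release_unfold hlen).2 ⟨ih₂ h.1, .inr (.inl rfl)⟩
  | eventuallyTail =>
    exact (holds_untl_unfold hlen).2 (.inl (holds_atom_letter_cons.2 hA))

/-- The set of subformulas of a formula. -/
def subformulas [DecidableEq α] : Formula α → Finset (Formula α)
  | tt => {tt}
  | ff => {ff}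
  | atom p => {atom p}
  | neg φ => insert (neg φ) (subformulas φ)
  | and φ ψ => insert (and φ ψ) (subformulas φ ∪ subformulas ψ)
  | or φ ψ => insert (or φ ψ) (subformulas φ ∪ subformulas ψ)
  | next φ => insert (next φ) (subformulas φ)
  | wnext φ => insert (wnext φ) (subformulas φ)
  | untl φ ψ => insert (untl φ ψ) (subformulas φ ∪ subformulas ψ)
  | release φ ψ => insert (release φ ψ) (subformulas φ ∪ subformulas ψ)

theorem self_mem_subformulas [DecidableEq α] (φ : Formula α) : φ ∈ subformulas φ := by
  cases φ <;> simp [subformulas]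

theorem subformulas_subset [DecidableEq α] {φ θ : Formula α} (h : θ ∈ subformulas φ) :
    subformulas θ ⊆ subformulas φ := by
  induction φ with
  | tt | ff | atom p =>
    simp only [subformulas, Finset.mem_singleton] at h
    exact h ▸ subset_rfl
  | neg φ ih | next φ ih | wnext φ ih =>
    rcases Finset.mem_insert.1 h with rfl | h
    · rfl
    · exact (ih h).trans (Finset.subset_insert _ _)
  | and φ ψ ih₁ ih₂ | or φ ψ ih₁ ih₂ | untl φ ψ ih₁ ih₂ | release φ ψ ih₁ ih₂ =>
    rcases Finset.mem_insert.1 h with rfl | h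
    · rfl
    · refine Finset.Subset.trans ?_ (Finset.subset_insert _ _)
      rcases Finset.mem_union.1 h with h | h
      · exact (ih₁ h).trans Finset.subset_union_left
      · exact (ih₂ h).trans Finset.subset_union_right

theorem mem_subformulas_of_mem_propAtoms_xnf [DecidableEq α] {θ χ : Formula α}
    (h : χ.next ∈ propAtoms θ.xnf) : χ ∈ subformulas θ := by
  induction θ with
  | tt | ff | atom p | wnext φ ih => simp [xnf, propAtoms] at h
  | neg φ ih => simp [subformulas, ih h]
  | and φ ψ ih₁ ih₂ | or φ ψ ih₁ ih₂ =>
    simp only [xnf, propAtoms, Finset.mem_union] at h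
    simp only [subformulas, Finset.mem_insert, Finset.mem_union]
    exact .inr (h.imp ih₁ ih₂)
  | next φ ih =>
    simp only [xnf, propAtoms, Finset.mem_singleton, next.injEq] at h
    simp [subformulas, h, self_mem_subformulas]
  | untl φ ψ ih₁ ih₂ | release φ ψ ih₁ ih₂ =>
    simp only [xnf, propAtoms, Finset.mem_union, Finset.mem_singleton, next.injEq] at h
    simp only [subformulas, Finset.mem_insert, Finset.mem_union]
    tauto

end Formula

end LTLf

namespace LTLf

open Formula

variable {α : Type*}

/-! ### Soundness of the answers -/

/-- The state `s`, read as a conjunction, is satisfiable. -/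
def State.Satisfiable (s : State α) : Prop :=
  ∃ w : List (Set α), w ≠ [] ∧ ∀ θ ∈ s, Holds w 0 θ

theorem State.satisfiable_singleton {φ : Formula α} :
    State.Satisfiable {φ} ↔ φ.Satisfiable := by
  simp [State.Satisfiable, Formula.Satisfiable]

theorem IsFinal.satisfiable [DecidableEq α] {s : State (Option α)} (hs : ∀ θ ∈ s, TailNormal θ)
    (h : IsFinal s) : s.Satisfiable := by
  obtain ⟨A, -, h₁, h₂⟩ := h
  exact ⟨[letter A], by simp, fun θ hθ =>
    (hs θ hθ).holds_singleton_of_propEval_xnf h₁ (propEval_state_xnf.1 h₂ θ hθ)⟩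

theorem State.Satisfiable.of_nextState [DecidableEq α]
    {s : State (Option α)} (hs : ∀ θ ∈ s, TailNormal θ)
    {χ : Formula (Option α)} {A : Finset (Formula (Option α))} (hA : IsPropModel A (query χ s))
    (h : State.Satisfiable (nextState A)) : s.Satisfiable := by
  obtain ⟨w, hw, h⟩ := h
  exact ⟨letter A :: w, by simp, fun θ hθ => (hs θ hθ).holds_of_propEval_xnf hw
    (fun χ hχ => h χ (mem_nextState.2 hχ)) (propEval_state_xnf.1 hA.2.2 θ hθ)⟩

/-- A finite set of formulas in tail normal form that contains the states reachable from its
subsets. -/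
structure IsClosure [DecidableEq α] (cl : Finset (Formula (Option α))) : Prop where
  tailNormal : ∀ θ ∈ cl, TailNormal θ
  next_mem : ∀ θ ∈ cl, ∀ χ, χ.next ∈ propAtoms θ.xnf → χ ∈ cl

-- The filter is needed because a bare `next χ` is a subformula without being in tail normal form;
-- such a formula never enters a state, only `χ` does.
open Classical in
theorem exists_isClosure [DecidableEq α] {φ : Formula (Option α)} (hφ : TailNormal φ) :
    ∃ cl, IsClosure cl ∧ φ ∈ cl := by
  refine ⟨(subformulas φ).filter TailNormal, ⟨by simp, fun θ hθ χ h => ?_⟩,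
    by simp [self_mem_subformulas, hφ]⟩
  simp only [Finset.mem_filter] at hθ ⊢
  exact ⟨subformulas_subset hθ.1 (mem_subformulas_of_mem_propAtoms_xnf h),
    hθ.2.of_mem_propAtoms_xnf h⟩

/-- A model may also make variables of `X(F)` true that do not occur in `xnf(s)`, so the next state
may contain members of old cores; this is why `hF` is required. -/
theorem IsClosure.nextState_subset [DecidableEq α]
    {cl : Finset (Formula (Option α))} (hcl : IsClosure cl)
    {F : Frame (Option α)} (hF : ∀ c ∈ F, c ⊆ cl) {s : State (Option α)} (hs : s ⊆ cl)
    {A : Finset (Formula (Option α))} (hA : IsPropModel A (query (.neg F.nextFormula) s)) :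
    nextState A ⊆ cl := by
  intro χ hχ
  have := hA.1 (mem_nextState.1 hχ)
  simp only [query, propAtoms, Finset.mem_union, Frame.nextFormula, State.xnf,
    mem_propAtoms_listOr, mem_propAtoms_listAnd, List.mem_map, Finset.mem_toList] at this
  rcases this with ⟨_, ⟨c, hc, rfl⟩, h⟩ | ⟨_, ⟨θ, hθ, rfl⟩, h⟩
  · rw [mem_propAtoms_listAnd] at h
    obtain ⟨_, h, h'⟩ := h
    obtain ⟨θ, hθ, rfl⟩ := List.mem_map.1 h
    simp only [propAtoms, Finset.mem_singleton, Formula.next.injEq] at h'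
    exact h' ▸ hF c hc (Finset.mem_toList.1 hθ)
  · exact hcl.next_mem θ (hs hθ) χ h

/-- The frames consist of subsets of `cl`; no member of the frame `0` is final, and each successor
of a member of the frame `l + 1` is covered by the frame `l`. -/
structure Frames.Sound [DecidableEq α]
    (cl : Finset (Formula (Option α))) (C : Frames (Option α)) : Prop where
  subset : ∀ l, ∀ c ∈ C l, c ⊆ cl
  not_final : ∀ c ∈ C 0, ¬ IsFinal c
  succ_covered : ∀ l, ∀ c ∈ C (l + 1), ¬ PropSat (query (.neg (C l).nextFormula) c)

theorem Frames.subset_add [DecidableEq α]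
    (C : Frames α) (i : ℕ) (c : State α) (j : ℕ) : C j ⊆ C.add i c j := by
  rcases eq_or_ne j i with rfl | h
  · simp [Frames.add]
  · simp [Frames.add, h]

theorem Frames.mem_add [DecidableEq α] {C : Frames α} {i j : ℕ} {c d : State α} :
    d ∈ C.add i c j ↔ d ∈ C j ∨ (j = i ∧ d = c) := by
  rcases eq_or_ne j i with rfl | h
  · simp [Frames.add, or_comm]
  · simp [Frames.add, h]

theorem Frames.Sound.add [DecidableEq α] {cl : Finset (Formula (Option α))} {C : Frames (Option α)}
    (hC : C.Sound cl) {i : ℕ} {c : State (Option α)} (hc : c ⊆ cl)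
    (h₀ : i = 0 → ¬ IsFinal c)
    (h₁ : ∀ l, i = l + 1 → ¬ PropSat (query (.neg (C l).nextFormula) c)) :
    (C.add i c).Sound cl where
  subset l d hd := by
    rcases Frames.mem_add.1 hd with hd | ⟨-, rfl⟩
    exacts [hC.subset l d hd, hc]
  not_final d hd := by
    rcases Frames.mem_add.1 hd with hd | ⟨h, rfl⟩
    exacts [hC.not_final d hd, h₀ h.symm]
  succ_covered l d hd h := by
    have h₂ := propSat_query_neg_nextFormula_anti (C.subset_add i c l) h
    rcases Frames.mem_add.1 hd with hd | ⟨h', rfl⟩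
    exacts [hC.succ_covered l d hd h₂, h₁ l h'.symm h₂]

/-- All successors of `{φ}` are covered by `F`. -/
def Frame.Covers [DecidableEq α] (φ : Formula (Option α)) (F : Frame (Option α)) : Prop :=
  ¬ PropSat (query (.neg F.nextFormula) {φ})

theorem Frame.Covers.mono [DecidableEq α] {φ : Formula (Option α)} {F G : Frame (Option α)}
    (h : F.Covers φ) (hFG : F ⊆ G) : G.Covers φ :=
  fun h' => h (propSat_query_neg_nextFormula_anti hFG h')

/-- On a trace that ends at its first `Tail`, covering propagates to the next position. -/
theorem holds_toFormula_succ [DecidableEq α] {F : Frame (Option α)} {s : State (Option α)}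
    (hs : ∀ θ ∈ s, TailNormal θ) (h : ¬ PropSat (query (.neg F.nextFormula) s))
    {w : List (Set (Option α))} (hw : TailAtEnd w) {p : ℕ} (hp : p + 1 < w.length)
    (hps : ∀ θ ∈ s, Holds w p θ) : Holds w (p + 1) F.toFormula := by
  by_contra h'
  refine h (propSat_of_holds (w := w) (i := p) ⟨fun hF => h' ?_, holds_state_xnf.2 fun θ hθ =>
    (hs θ hθ).holds_xnf hw (by lia) (hps θ hθ)⟩)
  obtain ⟨c, hc, hF⟩ := holds_nextFormula.1 hF
  exact holds_toFormula.2 ⟨c, hc, fun θ hθ => (hF θ hθ).2⟩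

theorem not_holds_of_not_isFinal [DecidableEq α] {s : State (Option α)} (hs : ∀ θ ∈ s, TailNormal θ)
    (h : ¬ IsFinal s) {w : List (Set (Option α))} (hw : TailAtEnd w) {p : ℕ}
    (hp : p + 1 = w.length) : ¬ ∀ θ ∈ s, Holds w p θ :=
  fun hps => h (propSat_of_holds (w := w) (i := p) ⟨(hw p (by lia)).2 hp, holds_state_xnf.2
    fun θ hθ => (hs θ hθ).holds_xnf hw (by lia) (hps θ hθ)⟩)

/-- On a marked trace of `φ`, the frames `0, …, i` all hold at every position after the first:
initially since they cover `{φ}`, then by shifting `C (j + 1)` to `C j`, where the found implication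
supplies the top frame `C (i + 1)`. -/
theorem not_holds_of_invFound [DecidableEq α]
    {cl : Finset (Formula (Option α))} (hcl : IsClosure cl)
    {φ : Formula (Option α)} (hφ : φ ∈ cl) (hfin : ¬ IsFinal {φ}) {C : Frames (Option α)}
    (hC : C.Sound cl) {k : ℕ} (hcov : ∀ j ≤ k, (C j).Covers φ) (hinv : InvFound C k)
    {w : List (Set (Option α))} (hw : TailAtEnd w) (hne : w ≠ []) : ¬ Holds w 0 φ := by
  intro h
  have hφ' : ∀ θ ∈ ({φ} : State (Option α)), TailNormal θ := by
    simpa using hcl.tailNormal φ hφ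
  have h' : ∀ θ ∈ ({φ} : State (Option α)), Holds w 0 θ := by simpa using h
  have hpos := List.length_pos_iff.2 hne
  obtain ⟨i, hik, hi⟩ := hinv
  have htn : ∀ l, ∀ c ∈ C l, ∀ θ ∈ c, TailNormal θ := fun l c hc θ hθ =>
    hcl.tailNormal θ (hC.subset l c hc hθ)
  have key : ∀ p, p + 1 < w.length → ∀ j ≤ i, Holds w (p + 1) (C j).toFormula := by
    intro p
    induction p with
    | zero =>
      intro hp j hj
      exact holds_toFormula_succ hφ' (hcov j (by lia)) hw hp h'
    | succ p ih =>
      intro hp j hj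
      have hall := ih (by lia)
      have hlast : Holds w (p + 1) (C (i + 1)).toFormula := by
        by_contra hlast
        refine hi (propSat_of_holds (w := w) (i := p + 1) ⟨holds_listAnd.2 ?_, hlast⟩)
        simpa [Nat.lt_succ_iff] using hall
      have : Holds w (p + 1) (C (j + 1)).toFormula := by
        rcases hj.eq_or_lt with rfl | hlt
        exacts [hlast, hall (j + 1) hlt]
      obtain ⟨c, hc, hcw⟩ := holds_toFormula.1 this
      exact holds_toFormula_succ (htn _ c hc) (hC.succ_covered j c hc) hw hp hcw
  by_cases hl : w.length = 1
  · exact not_holds_of_not_isFinal hφ' hfin hw (p := 0) (by lia) h'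
  -- The position `w.length - 2 + 1` is the last one, where a member of `C 0` would have to be
  -- final.
  · obtain ⟨c, hc, hcw⟩ := holds_toFormula.1 (key (w.length - 2) (by lia) 0 (by lia))
    exact not_holds_of_not_isFinal (htn 0 c hc) (hC.not_final c hc) hw (by lia) hcw

/-! ### The bound on the number of frames -/

-- Each failed implication gives an assignment satisfying `C 0, …, C i` but not `C (i + 1)`. The
-- sets `P i` of assignments to the variables `B` thus drop in size `k + 1` times, starting from at
-- most `2 ^ B.card`.
open Classical in
theorem lt_of_not_invFound [DecidableEq α]
    {cl : Finset (Formula (Option α))} {C : Frames (Option α)}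
    (hC : ∀ l, ∀ c ∈ C l, c ⊆ cl) {k : ℕ} (h : ¬ InvFound C k) :
    k < 2 ^ (cl.biUnion propAtoms).card := by
  set B := cl.biUnion propAtoms with hB
  have hrestrict : ∀ A j, PropEval (A ∩ B) (C j).toFormula ↔ PropEval A (C j).toFormula := by
    intro A j
    simp only [propEval_toFormula]
    refine exists_congr fun c => and_congr_right fun hc => forall₂_congr fun θ hθ =>
      propEval_congr fun a ha => ?_
    have : a ∈ B := Finset.mem_biUnion.2 ⟨θ, hC j c hc hθ, ha⟩
    simp [this]
  let P : ℕ → Finset (Finset (Formula (Option α))) := fun i =>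
    B.powerset.filter fun A => ∀ j ≤ i, PropEval A (C j).toFormula
  have hstep : ∀ i ≤ k, (P (i + 1)).card < (P i).card := by
    intro i hi
    refine Finset.card_lt_card ⟨fun A hA => ?_, fun hsub => ?_⟩
    · simp only [P, Finset.mem_filter] at hA ⊢
      exact ⟨hA.1, fun j hj => hA.2 j (by lia)⟩
    · obtain ⟨A, -, h₁, h₂⟩ : PropSat _ := not_not.1 fun hn => h ⟨i, hi, hn⟩
      have hmem : A ∩ B ∈ P i := by
        simp only [P, Finset.mem_filter, Finset.mem_powerset, Finset.inter_subset_right,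
          true_and, hrestrict]
        intro j hj
        exact propEval_listAnd.1 h₁ _ (List.mem_map.2 ⟨j, by simpa using by lia, rfl⟩)
      exact h₂ ((hrestrict A _).1 ((Finset.mem_filter.1 (hsub hmem)).2 (i + 1) le_rfl))
  have hcard : ∀ i ≤ k + 1, (P i).card + i ≤ (P 0).card := by
    intro i
    induction i with
    | zero => simp
    | succ i ih =>
      intro hi
      have := ih (by lia)
      have := hstep i (by lia)
      lia
  have h₁ := hcard (k + 1) le_rfl
  have h₂ : (P 0).card ≤ 2 ^ B.card := by
    rw [← Finset.card_powerset]
    exact Finset.card_filter_le _ _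
  lia

/-! ### The invariant of the machine -/

/-- The chain of pending calls of `try_satisfy`, from `f` to the outermost one. Each call except the
outermost one works on a state that its caller has not blocked so far. -/
def StackInv (φ : Formula (Option α)) (cl : Finset (Formula (Option α))) (k : ℕ)
    (C : Frames (Option α)) : Call (Option α) → List (Call (Option α)) → Prop
  | f, [] => f.state ⊆ cl ∧ (f.state.Satisfiable → φ.Satisfiable) ∧ f.state = {φ} ∧ f.level = k
  | f, g :: st => f.state ⊆ cl ∧ (f.state.Satisfiable → φ.Satisfiable) ∧
      g.level = f.level + 1 ∧ (∀ c ∈ C (f.level + 1), ¬ c ⊆ f.state) ∧ StackInv φ cl k C g st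

section StackInv

variable {φ : Formula (Option α)} {cl : Finset (Formula (Option α))} {k : ℕ}
  {C C' : Frames (Option α)} {f : Call (Option α)} {st : List (Call (Option α))}

theorem StackInv.subset (h : StackInv φ cl k C f st) : f.state ⊆ cl := by
  cases st <;> exact h.1

theorem StackInv.satisfiable (h : StackInv φ cl k C f st) (hf : f.state.Satisfiable) :
    φ.Satisfiable := by
  cases st <;> exact h.2.1 hf

theorem StackInv.level_add_length (h : StackInv φ cl k C f st) : f.level + st.length = k := by
  induction st generalizing f with
  | nil => exact h.2.2.2
  | cons g st ih =>
    have h₁ := ih h.2.2.2.2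
    have h₂ := h.2.2.1
    rw [List.length_cons]
    lia

/-- The stack records only facts about frames strictly above the level of the innermost call, so
updates at or below that level do not disturb it. -/
theorem StackInv.congr (h : StackInv φ cl k C f st) (hC : ∀ j, f.level < j → C' j = C j) :
    StackInv φ cl k C' f st := by
  induction st generalizing f with
  | nil => exact h
  | cons g st ih =>
    obtain ⟨h₁, h₂, h₃, h₄, h₅⟩ := h
    exact ⟨h₁, h₂, h₃, by rwa [hC _ (by lia)], ih h₅ fun j hj => hC j (by lia)⟩

end StackInv

/-- What holds for the frames throughout the round `k` of the main loop. -/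
structure RoundInv [DecidableEq α]
    (φ : Formula (Option α)) (cl : Finset (Formula (Option α))) (k : ℕ)
    (C : Frames (Option α)) : Prop where
  not_final : ¬ IsFinal {φ}
  sound : C.Sound cl
  eq_empty : ∀ j, k + 1 < j → C j = ∅
  covers : ∀ j < k, (C j).Covers φ

theorem RoundInv.add [DecidableEq α]
    {φ : Formula (Option α)} {cl : Finset (Formula (Option α))} {k : ℕ}
    {C : Frames (Option α)} (h : RoundInv φ cl k C) {i : ℕ} {c : State (Option α)}
    (hC : (C.add i c).Sound cl) (hi : i ≤ k + 1) : RoundInv φ cl k (C.add i c) where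
  not_final := h.not_final
  sound := hC
  eq_empty j hj := by
    rw [Frames.add, Function.update_of_ne (by lia)]
    exact h.eq_empty j hj
  covers j hj := (h.covers j hj).mono (C.subset_add i c j)

/-- The invariant of the machine. -/
def Config.Inv [DecidableEq α] (φ : Formula (Option α)) (cl : Finset (Formula (Option α))) :
    Config (Option α) → Prop
  | .start => True
  | .loop k C => RoundInv φ cl k C
  | .run f stack k C => RoundInv φ cl k C ∧ StackInv φ cl k C f stack
  | .ret true _ _ _ => φ.Satisfiable
  | .ret false [] k C => RoundInv φ cl k C ∧ (C k).Covers φ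
  | .ret false (f :: stack) k C => RoundInv φ cl k C ∧ StackInv φ cl k C f stack
  | .halt .SAT => φ.Satisfiable
  | .halt .UNSAT => ∀ w, w ≠ [] → TailAtEnd w → ¬ Holds w 0 φ

/-- The number of subsets of `cl` that are missing in the frames `0, …, k`. -/
def Frames.missing (cl : Finset (Formula (Option α))) (k : ℕ) (C : Frames (Option α)) : ℕ :=
  ∑ j ∈ Finset.range (k + 1), (cl.powerset.card - (C j).card)

theorem Frames.missing_add_lt [DecidableEq α]
    {cl : Finset (Formula (Option α))} {k : ℕ} {C : Frames (Option α)}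
    (hC : ∀ l, ∀ c ∈ C l, c ⊆ cl) {i : ℕ} (hi : i ≤ k) {c : State (Option α)} (hc : c ⊆ cl)
    (hci : c ∉ C i) : (C.add i c).missing cl k < C.missing cl k := by
  refine Finset.sum_lt_sum (fun j _ => ?_) ⟨i, Finset.mem_range.2 (by lia), ?_⟩
  · exact Nat.sub_le_sub_left (Finset.card_le_card (C.subset_add i c j)) _
  · have h₁ : C.add i c i = insert c (C i) := by simp [Frames.add]
    -- Without this bound the truncated subtraction might not decrease strictly.
    have h₂ : (insert c (C i)).card ≤ cl.powerset.card := by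
      refine Finset.card_le_card fun d hd => Finset.mem_powerset.2 ?_
      rcases Finset.mem_insert.1 hd with rfl | hd
      exacts [hc, hC i d hd]
    rw [Finset.card_insert_of_notMem hci] at h₂
    rw [h₁, Finset.card_insert_of_notMem hci]
    lia

theorem Frames.missing_congr {cl : Finset (Formula (Option α))} {k : ℕ} {C C' : Frames (Option α)}
    (h : ∀ j ≤ k, C' j = C j) : C'.missing cl k = C.missing cl k :=
  Finset.sum_congr rfl fun j hj => by rw [h j (by simpa [Nat.lt_succ_iff] using hj)]

/-- The termination measure, ordered lexicographically. -/
def Config.measure [DecidableEq α] (cl : Finset (Formula (Option α))) (K : ℕ) :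
    Config (Option α) → ℕ ×ₗ ℕ ×ₗ ℕ
  | .start => toLex (K + 2, toLex (0, 0))
  | .loop k C => toLex (K - k + 1, toLex (C.missing cl k, 2 * k + 2))
  | .run f _ k C => toLex (K - k + 1, toLex (C.missing cl k, k + 1 + f.level))
  | .ret true stack k C => toLex (K - k + 1, toLex (C.missing cl k, stack.length))
  | .ret false [] k C => toLex (K - k + 1, toLex (C.missing cl k, 0))
  | .ret false (_ :: _) k C => toLex (K - k + 1, toLex (C.missing cl k, 2 * k + 2))
  | .halt _ => toLex (0, toLex (0, 0))

theorem toLex_lt_of_fst {a b : ℕ} {p q : ℕ ×ₗ ℕ} (h : a < b) :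
    (toLex (a, p) : ℕ ×ₗ ℕ ×ₗ ℕ) < toLex (b, q) :=
  Prod.Lex.toLex_lt_toLex.2 (.inl h)

theorem toLex_lt_of_snd {a b c d e : ℕ} (h : b < d) :
    (toLex (a, toLex (b, c)) : ℕ ×ₗ ℕ ×ₗ ℕ) < toLex (a, toLex (d, e)) :=
  Prod.Lex.toLex_lt_toLex.2 (.inr ⟨rfl, Prod.Lex.toLex_lt_toLex.2 (.inl h)⟩)

theorem toLex_lt_of_thd {a b c d : ℕ} (h : c < d) :
    (toLex (a, toLex (b, c)) : ℕ ×ₗ ℕ ×ₗ ℕ) < toLex (a, toLex (b, d)) :=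
  Prod.Lex.toLex_lt_toLex.2 (.inr ⟨rfl, Prod.Lex.toLex_lt_toLex.2 (.inr ⟨rfl, h⟩)⟩)

/-- The first component of the measure drops with a new frame or a final answer, the second with
each core added to a frame up to `k`. All other steps lower the third: level plus stack length is
`k`, so a running call weighs at most `2 * k + 1`, less than a fresh round or a resumption, and more
than the stack unwound after success. -/
theorem Step.inv_and_measure_lt [DecidableEq α]
    {φ : Formula (Option α)} {cl : Finset (Formula (Option α))}
    (hcl : IsClosure cl) (hφ : φ ∈ cl) {c c' : Config (Option α)} (h : Step φ c c')
    (hc : c.Inv φ cl) : c'.Inv φ cl ∧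
      c'.measure cl (2 ^ (cl.biUnion propAtoms).card) <
        c.measure cl (2 ^ (cl.biUnion propAtoms).card) := by
  have hφ' : ({φ} : State (Option α)) ⊆ cl := by simpa using hφ
  cases h with
  | startSat h =>
    exact ⟨State.satisfiable_singleton.1 (h.satisfiable fun θ hθ => hcl.tailNormal θ (hφ' hθ)),
      toLex_lt_of_fst (by lia)⟩
  | startLoop h =>
    refine ⟨⟨h, ⟨?_, ?_, ?_⟩, ?_, by simp⟩, toLex_lt_of_fst (by lia)⟩
    · intro l c hc
      rcases eq_or_ne l 0 with rfl | hl
      · simp only [Function.update_self, Finset.mem_singleton] at hc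
        exact hc ▸ hφ'
      · simp [hl] at hc
    · simpa using h
    · simp
    · intro j hj
      simp [show j ≠ 0 by lia]
  | call k C => exact ⟨⟨hc, hφ', State.satisfiable_singleton.1, rfl, rfl⟩, toLex_lt_of_thd (by lia)⟩
  | found s stack k C A hA hf =>
    obtain ⟨hC, hst⟩ := hc
    have hs := hst.subset
    have hA' := hcl.nextState_subset (hC.sound.subset 0) hs hA
    have hlen := hst.level_add_length
    refine ⟨hst.satisfiable (.of_nextState (fun θ hθ => hcl.tailNormal θ (hs hθ)) hA
      (hf.satisfiable fun θ hθ => hcl.tailNormal θ (hA' hθ))), toLex_lt_of_thd ?_⟩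
    dsimp only at hlen ⊢
    lia
  | block s stack k C A c hA hf hc' =>
    obtain ⟨hC, hst⟩ := hc
    have hA' := hcl.nextState_subset (hC.sound.subset 0) hst.subset hA
    have hccl := hc'.1.trans hA'
    refine ⟨⟨hC.add (hC.sound.add hccl (fun _ => hc'.2) (by lia)) (by lia), hst.congr ?_⟩,
      toLex_lt_of_snd (Frames.missing_add_lt hC.sound.subset (by lia) hccl
        (not_subset_nextState hA hc'.1))⟩
    intro j hj
    exact Function.update_of_ne (by lia) _ _
  | descend s l stack k C A hA =>
    obtain ⟨hC, hst⟩ := hc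
    have hs := hst.subset
    exact ⟨⟨hC, hcl.nextState_subset (hC.sound.subset _) hs hA, fun h => hst.satisfiable
      (h.of_nextState (fun θ hθ => hcl.tailNormal θ (hs hθ)) hA), rfl,
      fun c hc hcA => not_subset_nextState hA hcA hc, hst⟩,
      toLex_lt_of_thd (by dsimp only; lia)⟩
  | exhausted s l stack k C c hs hc' =>
    obtain ⟨hC, hst⟩ := hc
    have hccl := hc'.1.trans hst.subset
    have hlen := hst.level_add_length
    have hC' : RoundInv φ cl k (C.add (l + 1) c) := by
      refine hC.add (hC.sound.add hccl (by lia) ?_) (by dsimp only at hlen; lia)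
      intro m hm
      obtain rfl : l = m := by lia
      exact hc'.2
    cases stack with
    | nil =>
      obtain ⟨-, -, rfl, rfl⟩ := hst
      have heq : ∀ j ≤ l, C.add (l + 1) c j = C j := fun j hj =>
        Function.update_of_ne (by lia) _ _
      refine ⟨⟨hC', ?_⟩, ?_⟩
      · rw [heq l le_rfl]
        exact hs
      -- The core of the outermost call goes to frame `k + 1`, which is not counted; here the third
      -- component falls to `0`.
      · simp only [Config.measure, Frames.missing_congr heq]
        exact toLex_lt_of_thd (by lia)
    | cons g stack =>
      simp only [List.length_cons] at hlen
      obtain ⟨-, -, hlev, hnot, hst⟩ := hst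
      refine ⟨⟨hC', hst.congr fun j hj => Function.update_of_ne (by dsimp only at hlev; lia) _ _⟩,
        -- The core is new: it lies inside the state of the callee, and the stack invariant says
        -- that no member of frame `l + 1` does.
        toLex_lt_of_snd (Frames.missing_add_lt hC.sound.subset (by lia) hccl
          fun hmem => hnot c hmem hc'.1)⟩
  | retTrue f stack k C => exact ⟨hc, toLex_lt_of_thd (by simp)⟩
  | retFalse f stack k C =>
    have := hc.2.level_add_length
    exact ⟨hc, toLex_lt_of_thd (by lia)⟩
  | answerSat k C => exact ⟨hc, toLex_lt_of_fst (by lia)⟩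
  | answerUnsat k C h =>
    obtain ⟨hC, hcov⟩ := hc
    refine ⟨fun w hne hw => not_holds_of_invFound hcl hφ hC.not_final hC.sound ?_ h hw hne,
      toLex_lt_of_fst (by lia)⟩
    intro j hj
    rcases hj.eq_or_lt with rfl | hlt
    exacts [hcov, hC.covers j hlt]
  | newFrame k C h =>
    obtain ⟨hC, hcov⟩ := hc
    have hk := lt_of_not_invFound hC.sound.subset h
    have hsub : ∀ j, Function.update C (k + 1) ∅ j ⊆ C j := by
      intro j
      rcases eq_or_ne j (k + 1) with rfl | hj
      · simp
      · simp [hj]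
    have heq : ∀ j, j ≠ k + 1 → Function.update C (k + 1) ∅ j = C j := fun j hj =>
      Function.update_of_ne hj _ _
    refine ⟨⟨hC.not_final, ⟨fun l c hc => hC.sound.subset l c (hsub l hc),
      fun c hc => hC.sound.not_final c (hsub 0 hc), fun l c hc => ?_⟩, fun j hj => ?_,
      fun j hj => ?_⟩, toLex_lt_of_fst (by lia)⟩
    · rcases eq_or_ne l (k + 1) with rfl | hl
      -- Emptying frame `k + 1` could only uncover members of frame `k + 2`, and there are none.
      · have := hsub _ hc
        simp [hC.eq_empty (k + 1 + 1) (by lia)] at this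
      · rw [heq l hl]
        exact hC.sound.succ_covered l c (hsub _ hc)
    · rw [heq j (by lia)]
      exact hC.eq_empty j (by lia)
    · rw [heq j (by lia)]
      rcases (Nat.lt_succ_iff.1 hj).eq_or_lt with rfl | hlt
      exacts [hcov, hC.covers j hlt]

/-! ### Runs: invariance, termination and progress. -/

theorem Reachable.inv [DecidableEq α] {φ : Formula (Option α)} {cl : Finset (Formula (Option α))}
    (hcl : IsClosure cl) (hφ : φ ∈ cl) {c : Config (Option α)} (h : Reachable φ c) :
    c.Inv φ cl := by
  induction h with
  | refl => trivial
  | tail _ hstep ih => exact (hstep.inv_and_measure_lt hcl hφ ih).1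

theorem not_exists_infinite_run [DecidableEq α] {φ : Formula (Option α)} (hφ : TailNormal φ) :
    ¬ ∃ run : ℕ → Config (Option α), run 0 = .start ∧ ∀ n, Step φ (run n) (run (n + 1)) := by
  rintro ⟨run, h₀, hrun⟩
  obtain ⟨cl, hcl, hφ⟩ := exists_isClosure hφ
  have hinv : ∀ n, (run n).Inv φ cl := by
    intro n
    induction n with
    | zero => rw [h₀]; trivial
    | succ n ih => exact ((hrun n).inv_and_measure_lt hcl hφ ih).1
  exact not_strictAnti_of_wellFoundedLT
    (fun n => (run n).measure cl (2 ^ (cl.biUnion propAtoms).card))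
    (strictAnti_nat_of_succ_lt fun n => ((hrun n).inv_and_measure_lt hcl hφ (hinv n)).2)

theorem exists_step [DecidableEq α] (φ : Formula (Option α)) {c : Config (Option α)}
    (hc : ∀ r, c ≠ .halt r) : ∃ c', Step φ c c' := by
  cases c with
  | start =>
    by_cases h : IsFinal {φ}
    exacts [⟨_, .startSat h⟩, ⟨_, .startLoop h⟩]
  | loop k C => exact ⟨_, .call k C⟩
  | run f stack k C =>
    obtain ⟨s, l⟩ := f
    by_cases h : PropSat (query (.neg (C l).nextFormula) s)
    · obtain ⟨A, hA⟩ := h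
      cases l with
      | zero =>
        by_cases hf : IsFinal (nextState A)
        exacts [⟨_, .found s stack k C A hA hf⟩,
          -- The whole state always serves as an unsatisfiable core.
          ⟨_, .block s stack k C A _ hA hf ⟨subset_rfl, hf⟩⟩]
      | succ l => exact ⟨_, .descend s l stack k C A hA⟩
    · exact ⟨_, .exhausted s l stack k C s h ⟨subset_rfl, h⟩⟩
  | ret b stack k C =>
    rcases b with _ | _ <;> rcases stack with _ | ⟨f, stack⟩
    · by_cases h : InvFound C k
      exacts [⟨_, .answerUnsat k C h⟩, ⟨_, .newFrame k C h⟩]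
    exacts [⟨_, .retFalse f stack k C⟩, ⟨_, .answerSat k C⟩, ⟨_, .retTrue f stack k C⟩]
  | halt r => exact absurd rfl (hc r)

end LTLf

theorem mainTheorem1 {α : Type*} [DecidableEq α] (φ : LTLf.Formula α) :
    -- there is no infinite run
    (¬ ∃ run : ℕ → LTLf.Config (Option α),
        run 0 = LTLf.Config.start ∧ ∀ n, LTLf.Step φ.tnf (run n) (run (n + 1))) ∧
    -- a run can stop only by returning an answer
    (∀ c : LTLf.Config (Option α), LTLf.Reachable φ.tnf c → (¬ ∃ c', LTLf.Step φ.tnf c c') →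
        ∃ r : LTLf.Answer, c = LTLf.Config.halt r) ∧
    -- every answer that can be returned is correct
    (∀ r : LTLf.Answer, LTLf.Reachable φ.tnf (LTLf.Config.halt r) →
        (r = LTLf.Answer.SAT ↔ φ.Satisfiable) ∧ (r = LTLf.Answer.UNSAT ↔ ¬ φ.Satisfiable) ∧
        (r = LTLf.Answer.SAT ↔ φ.tnf.Satisfiable)) := by
  refine ⟨LTLf.not_exists_infinite_run (LTLf.Formula.tailNormal_tnf φ), fun c _ hc => ?_,
    fun r hr => ?_⟩
  · by_contra! h
    exact hc (LTLf.exists_step _ h)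
  · obtain ⟨cl, hcl, hφ⟩ := LTLf.exists_isClosure (LTLf.Formula.tailNormal_tnf φ)
    have hinv := hr.inv hcl hφ
    have hto : φ.Satisfiable → φ.tnf.Satisfiable := fun h =>
      let ⟨w, hne, _, hw⟩ := LTLf.Formula.exists_tailAtEnd_of_satisfiable h
      ⟨w, hne, hw⟩
    have hfrom := LTLf.Formula.satisfiable_of_satisfiable_tnf (φ := φ)
    cases r with
    | SAT =>
      have h : φ.tnf.Satisfiable := hinv
      simp [h, hfrom h]
    | UNSAT =>
      -- The invariant excludes only traces with `Tail` exactly at the end. That refutes `φ`, and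
      -- cutting at the first `Tail` then refutes `tnf φ` on arbitrary traces.
      have h : ¬ φ.Satisfiable := fun h =>
        let ⟨w, hne, htail, hw⟩ := LTLf.Formula.exists_tailAtEnd_of_satisfiable h
        hinv w hne htail hw
      have h' : ¬ φ.tnf.Satisfiable := fun h' => h (hfrom h')
      simp [h, h']
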